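/- Setting. There are $n$ agents and $m$ divisible resources of unit capacity. Agent $i$ has a demand vector $d_i\in[0,1]^m$ with $\max_r d_{ir}=1$ and has to complete an amount of work $k_i>0$. An allocation is a measurable map $t\mapsto A(t)\in\mathbb{R}^{n\times m}$ on $[0,\infty)$ such that, at every time $t$, $\sum_i A_{ir}(t)\le 1$ for each resource $r$ and $A_i(t)=\lambda_i(t)\,d_i$ for some $\lambda_i(t)\ge 0$, for each agent $i$. The cost $c_i(A_j)$ to agent $i$ of the bundle of agent $j$ is the first time $t$ with $k_i d_i\le\int_0^t A_j(s)\,ds$ in every coordinate ($\infty$ if there is no such time). An LCP (least cost product) allocation is an allocation that minimizes $\prod_i c_i(A_i)$ among all allocations, and an LCP mechanism is one that chooses an LCP allocation for each problem that has one (almost surely, if it is randomized). A mechanism is envy-free if $c_i(A_i)\le c_i(A_j)$ for all $i,j$ on every problem, and a randomized one is envy-free in expectation if $\mathbb{E}[c_i(A_i)]\le\mathbb{E}[c_i(A_j)]$ for all $i,j$ on every problem. Lemma. For all $n\ge 3$ and $m\ge 2$, no LCP mechanism for $n$ agents and $m$ resources is envy-free, and no randomized LCP mechanism is envy-free in expectation.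 Moreover, let $n=3$, $m=2$, $d_1=(1,1)$, $d_2=(1,\varepsilon)$, $d_3=(\varepsilon,1)$, $k_1=k_2=1$, where $0<\varepsilon<1$ and $2<k_3<\frac{2}{\varepsilon}-3-\varepsilon$. Then an LCP allocation exists, and an allocation $A$ is an LCP allocation if and only if, for almost every $t\in[0,1+\varepsilon+k_3)$: if $t<1$, then $A_1(t)=(1,1)$ and $A_2(t)=A_3(t)=0$; if $1\le t<2+\varepsilon$, then $A_1(t)=0$, $A_2(t)=\frac{1}{1+\varepsilon}(1,\varepsilon)$ and $A_3(t)=\frac{1}{1+\varepsilon}(\varepsilon,1)$; if $t\ge 2+\varepsilon$, then $A_1(t)=A_2(t)=0$ and $A_3(t)=(\varepsilon,1)$. In every LCP allocation, $c_1(A_1)=1$, $c_2(A_2)=2+\varepsilon$, $c_3(A_3)=1+\varepsilon+k_3$, and agent 2 envies agent 1: $c_2(A_1)=1<2+\varepsilon=c_2(A_2)$. -/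

import Mathlib

open MeasureTheory
open scoped ENNReal NNReal

namespace LimitedDemands

/-- A fair division problem with `n` agents and `m` divisible resources of unit capacity:
`d i r` is the (normalized) demand of agent `i` for resource `r`, and `k i` is the amount of work
agent `i` has to complete. By the normalization, giving `d` and `k` is the same as giving the
matrix `W = K D` of required amounts. -/
structure Problem (n m : ℕ) where
  d : Matrix (Fin n) (Fin m) ℝ
  k : Fin n → ℝ
  d_nonneg : ∀ i r, 0 ≤ d i r
  d_le_one : ∀ i r, d i r ≤ 1
  exists_d_eq_one : ∀ i, ∃ r, d i r = 1
  k_pos : ∀ i, 0 < k i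

/-- The instantaneous allocations: no resource is used beyond its unit capacity, and every agent
receives a nonnegative multiple of its demand vector. -/
def Problem.IsInstantaneousAllocation {n m : ℕ} (I : Problem n m)
    (a : Matrix (Fin n) (Fin m) ℝ) : Prop :=
  (∀ r, ∑ i, a i r ≤ 1) ∧ ∀ i, ∃ l : ℝ, 0 ≤ l ∧ ∀ r, a i r = l * I.d i r

/-- An allocation: an instantaneous allocation at each time `t ≥ 0`, measurable in time.
The values at negative times play no role. -/
structure Allocation {n m : ℕ} (I : Problem n m) where
  toFun : ℝ → Matrix (Fin n) (Fin m) ℝ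
  measurable_toFun : ∀ i r, Measurable fun t => toFun t i r
  feasible : ∀ t, 0 ≤ t → I.IsInstantaneousAllocation (toFun t)

/-- `A.bundle j` is the stream of resources received by agent `j`. -/
def Allocation.bundle {n m : ℕ} {I : Problem n m} (A : Allocation I) (j : Fin n) :
    ℝ → Fin m → ℝ :=
  fun t r => A.toFun t j r

/-- The cost of a stream of resources `b` for agent `i`: the first time at which the resources
received suffice for the whole work `k i • d i` of the agent (`∞` if this never happens).
For the stream of agent `j` in an allocation, which is at all times proportional to `d j`, this
agrees with running agent `i` at the Leontief rate `min_r b_r(t) / d i r`. -/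
noncomputable def Problem.cost {n m : ℕ} (I : Problem n m) (i : Fin n) (b : ℝ → Fin m → ℝ) :
    ℝ≥0∞ :=
  ⨅ (t : ℝ≥0) (_ : ∀ r, I.k i * I.d i r ≤ ∫ s in (0 : ℝ)..(t : ℝ), b s r), (t : ℝ≥0∞)

/-- The product of the agents' costs for their own parts of the allocation. -/
noncomputable def Allocation.costProduct {n m : ℕ} {I : Problem n m} (A : Allocation I) : ℝ≥0∞ :=
  ∏ i, I.cost i (A.bundle i)

/-- `A` is a least cost product (LCP) allocation. -/
def Allocation.IsLCP {n m : ℕ} {I : Problem n m} (A : Allocation I) : Prop :=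
  ∀ B : Allocation I, A.costProduct ≤ B.costProduct

/-- A (deterministic) resource allocation mechanism. -/
def Mechanism (n m : ℕ) : Type :=
  (I : Problem n m) → Allocation I

/-- The mechanism always chooses an LCP allocation (wherever there is one). -/
def Mechanism.IsLCP {n m : ℕ} (f : Mechanism n m) : Prop :=
  ∀ I : Problem n m, (∃ A : Allocation I, A.IsLCP) → (f I).IsLCP

/-- Envy-freeness of a mechanism. -/
def Mechanism.IsEnvyFree {n m : ℕ} (f : Mechanism n m) : Prop :=
  ∀ (I : Problem n m) (i j : Fin n), I.cost i ((f I).bundle i) ≤ I.cost i ((f I).bundle j)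

/-- A randomized resource allocation mechanism, driven by a random seed `ω`. -/
structure RandomizedMechanism (n m : ℕ) where
  Ω : Type*
  [measurableSpace : MeasurableSpace Ω]
  P : Measure Ω
  [isProbabilityMeasure : IsProbabilityMeasure P]
  alloc : (I : Problem n m) → Ω → Allocation I
  measurable_cost : ∀ (I : Problem n m) (i j : Fin n),
    Measurable fun ω => I.cost i ((alloc I ω).bundle j)

attribute [instance] RandomizedMechanism.measurableSpace RandomizedMechanism.isProbabilityMeasure

/-- The mechanism almost surely chooses an LCP allocation (wherever there is one). -/
def RandomizedMechanism.IsLCP {n m : ℕ} (F : RandomizedMechanism n m) : Prop :=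
  ∀ I : Problem n m, (∃ A : Allocation I, A.IsLCP) → ∀ᵐ ω ∂F.P, (F.alloc I ω).IsLCP

/-- Envy-freeness in expectation. -/
def RandomizedMechanism.IsEnvyFreeInExpectation {n m : ℕ} (F : RandomizedMechanism n m) : Prop :=
  ∀ (I : Problem n m) (i j : Fin n),
    ∫⁻ ω, I.cost i ((F.alloc I ω).bundle i) ∂F.P ≤ ∫⁻ ω, I.cost i ((F.alloc I ω).bundle j) ∂F.P

/-- Three agents with demands `(1, 1)`, `(1, ε)`, `(ε, 1)` and work `1`, `1`, `k₃`. -/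
def envyProblem (ε k₃ : ℝ) (hε : 0 < ε) (hε1 : ε < 1) (hk : 2 < k₃) : Problem 3 2 where
  d := !![1, 1; 1, ε; ε, 1]
  k := ![1, 1, k₃]
  d_nonneg := by
    intro i r
    fin_cases i <;> fin_cases r <;> simp <;> linarith
  d_le_one := by
    intro i r
    fin_cases i <;> fin_cases r <;> simp <;> linarith
  exists_d_eq_one := by
    intro i
    fin_cases i
    · exact ⟨0, by simp⟩
    · exact ⟨0, by simp⟩
    · exact ⟨1, by simp⟩
  k_pos := by
    intro i
    fin_cases i <;> simp <;> linarith

/-- Agent 1 alone until time `1`, then agents 2 and 3 at equal dominant shares until time `2 + ε`,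
then agent 3 alone. -/
noncomputable def envySchedule (ε : ℝ) (t : ℝ) : Matrix (Fin 3) (Fin 2) ℝ :=
  if t < 1 then
    !![1, 1; 0, 0; 0, 0]
  else if t < 2 + ε then
    !![0, 0; 1 / (1 + ε), ε / (1 + ε); ε / (1 + ε), 1 / (1 + ε)]
  else
    !![0, 0; 0, 0; ε, 1]

end LimitedDemands

/-! In the three-agent problem (agents 1, 2, 3 have indices 0, 1, 2) agents 2 and 3 fit together
almost without waste, while agent 1 blocks everybody. Let `M` be the later finishing time of agents
1 and 2, and `x` the work agent 3 has done by then. The first resource gives `M ≥ 2 + ε x`, and the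
second, on which agent 3 still has to do `k - x`, gives `T₃ ≥ M + k - x`. Letting `x` grow to 1
delays `M` a little but lets agent 3 finish earlier; the upper bound on `k` makes this trade
profitable, so the optimum has `x = 1`. The earlier of agents 1 and 2 costs at least 1, and agent 2
cannot be the one with cost 1: afterwards agents 1 and 3 would compete for the second resource. So
agent 1 runs alone first, and its bundle would have finished agent 2 at time 1. This is
`envy_costProduct_bound`; tightness of its inequalities determines the schedule almost everywhere
(`EnvyOptimal.ae_eq`).

For more resources, duplicate one: bundles are proportional to demands, so costs do not change. For
more agents, add one with demand `(1, ..., 1)` and a huge amount of work. An LCP allocation must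
then serve it last, and induces an LCP allocation of the old agents. `Problem.ForcesEnvy` is the
invariant of this induction; its gap between costs at most 1 and at least 2 in every LCP allocation
also defeats envy-freeness in expectation. -/

namespace LimitedDemands

/-! ### Integrals and costs of general allocations -/

section General

variable {n m : ℕ} {I : Problem n m} (A : Allocation I)

theorem Allocation.toFun_nonneg {t : ℝ} (ht : 0 ≤ t) (i : Fin n) (r : Fin m) :
    0 ≤ A.toFun t i r := by
  obtain ⟨l, hl, h⟩ := (A.feasible t ht).2 i
  rw [h]
  exact mul_nonneg hl (I.d_nonneg i r)

theorem Allocation.toFun_le_one {t : ℝ} (ht : 0 ≤ t) (i : Fin n) (r : Fin m) :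
    A.toFun t i r ≤ 1 :=
  (Finset.single_le_sum (f := fun i => A.toFun t i r)
    (fun j _ => A.toFun_nonneg ht j r) (Finset.mem_univ i)).trans ((A.feasible t ht).1 r)

theorem Allocation.intervalIntegrable {a b : ℝ} (ha : 0 ≤ a) (hb : 0 ≤ b) (i : Fin n)
    (r : Fin m) : IntervalIntegrable (fun t => A.toFun t i r) volume a b := by
  refine (intervalIntegrable_const (c := (1 : ℝ))).mono_fun
    (A.measurable_toFun i r).aestronglyMeasurable ?_
  refine (ae_restrict_iff' measurableSet_uIoc).2 (Filter.Eventually.of_forall fun t ht => ?_)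
  have ht0 : 0 ≤ t := (le_min ha hb).trans ht.1.le
  simpa [abs_of_nonneg (A.toFun_nonneg ht0 i r)] using A.toFun_le_one ht0 i r

theorem Allocation.integral_nonneg {a b : ℝ} (ha : 0 ≤ a) (hab : a ≤ b) (i : Fin n)
    (r : Fin m) : 0 ≤ ∫ t in a..b, A.toFun t i r :=
  intervalIntegral.integral_nonneg hab fun _ ht => A.toFun_nonneg (ha.trans ht.1) i r

theorem Allocation.integral_le {a b : ℝ} (ha : 0 ≤ a) (hab : a ≤ b) (i : Fin n)
    (r : Fin m) : ∫ t in a..b, A.toFun t i r ≤ b - a := by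
  have := intervalIntegral.integral_mono_on hab (A.intervalIntegrable ha (ha.trans hab) i r)
    (intervalIntegrable_const (c := (1 : ℝ))) fun t ht => A.toFun_le_one (ha.trans ht.1) i r
  simpa using this

theorem Allocation.integral_add {a b c : ℝ} (ha : 0 ≤ a) (hb : 0 ≤ b) (hc : 0 ≤ c)
    (i : Fin n) (r : Fin m) :
    (∫ t in a..b, A.toFun t i r) + ∫ t in b..c, A.toFun t i r = ∫ t in a..c, A.toFun t i r :=
  intervalIntegral.integral_add_adjacent_intervals (A.intervalIntegrable ha hb i r)
    (A.intervalIntegrable hb hc i r)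

theorem Allocation.sum_integral_le {a b : ℝ} (ha : 0 ≤ a) (hab : a ≤ b) (r : Fin m) :
    ∑ i, ∫ t in a..b, A.toFun t i r ≤ b - a := by
  have hi := fun i => A.intervalIntegrable ha (ha.trans hab) i r
  rw [← intervalIntegral.integral_finsetSum fun i _ => hi i]
  have := intervalIntegral.integral_mono_on hab
    (IntervalIntegrable.sum Finset.univ fun i _ => hi i)
    (intervalIntegrable_const (c := (1 : ℝ))) fun t ht => by
      simpa using (A.feasible t (ha.trans ht.1)).1 r
  simpa using this

/-- The infimum defining the cost is attained. -/
theorem Allocation.cost_le_iff (i j : Fin n) {t : ℝ} (ht : 0 ≤ t) :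
    I.cost i (A.bundle j) ≤ ENNReal.ofReal t ↔
      ∀ r, I.k i * I.d i r ≤ ∫ s in (0 : ℝ)..t, A.toFun s j r := by
  constructor
  · intro h r
    -- Some admissible time lies below `t + δ`, and since rates are at most 1 the amount received by
    -- `t + δ` exceeds that received by `t` by at most `δ`.
    refine le_of_forall_pos_le_add fun δ hδ => ?_
    have h1 : I.cost i (A.bundle j) < ENNReal.ofReal (t + δ) :=
      h.trans_lt ((ENNReal.ofReal_lt_ofReal_iff (by linarith)).2 (by linarith))
    unfold Problem.cost at h1
    simp only [iInf_lt_iff] at h1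
    obtain ⟨s, hs, hlt⟩ := h1
    have hst : (s : ℝ) < t + δ := by
      rw [ENNReal.ofReal, ENNReal.coe_lt_coe, Real.lt_toNNReal_iff_coe_lt] at hlt
      exact hlt
    have h0 : 0 ≤ (s : ℝ) := s.2
    have h2 := A.integral_add le_rfl h0 (h0.trans hst.le) j r
    have h3 := A.integral_nonneg h0 hst.le j r
    have h4 := A.integral_add le_rfl ht (h0.trans hst.le) j r
    have h5 := A.integral_le ht (show t ≤ t + δ by linarith) j r
    have h6 : I.k i * I.d i r ≤ ∫ s in (0 : ℝ)..s, A.toFun s j r := hs r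
    linarith
  · intro h
    unfold Problem.cost
    refine (iInf₂_le (⟨t, ht⟩ : ℝ≥0) h).trans_eq ?_
    rw [ENNReal.ofReal, Real.toNNReal_of_nonneg ht]
    rfl

/-- Some resource has demand 1, and it arrives at rate at most 1. -/
theorem Allocation.k_le_cost (i j : Fin n) :
    ENNReal.ofReal (I.k i) ≤ I.cost i (A.bundle j) := by
  by_cases hc : I.cost i (A.bundle j) = ⊤
  · simp [hc]
  have h := (A.cost_le_iff i j (ENNReal.toReal_nonneg (a := I.cost i (A.bundle j)))).1
    (ENNReal.ofReal_toReal hc).ge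
  obtain ⟨r, hr⟩ := I.exists_d_eq_one i
  have h1 := h r
  have h2 := A.integral_le le_rfl (ENNReal.toReal_nonneg (a := I.cost i (A.bundle j))) j r
  rw [hr] at h1
  rw [ENNReal.ofReal_le_iff_le_toReal hc]
  linarith

/-- Since `⊤ * 0 = 0` in `ℝ≥0∞`, this needs the other costs to be nonzero, which follows from
`k_le_cost`. -/
theorem Allocation.cost_ne_top_of_costProduct_ne_top (h : A.costProduct ≠ ⊤) (i : Fin n) :
    I.cost i (A.bundle i) ≠ ⊤ := by
  intro hi
  apply h
  unfold Allocation.costProduct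
  rw [← Finset.mul_prod_erase _ _ (Finset.mem_univ i), hi, ENNReal.top_mul]
  rw [Finset.prod_ne_zero_iff]
  exact fun i _ => ((ENNReal.ofReal_pos.2 (I.k_pos i)).trans_le (A.k_le_cost i i)).ne'

theorem Allocation.integral_cost_ge {i : Fin n} (h : I.cost i (A.bundle i) ≠ ⊤) {t : ℝ}
    (ht : (I.cost i (A.bundle i)).toReal ≤ t) (r : Fin m) :
    I.k i * I.d i r ≤ ∫ s in (0 : ℝ)..t, A.toFun s i r :=
  (A.cost_le_iff i i (ENNReal.toReal_nonneg.trans ht)).1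
    ((ENNReal.le_ofReal_iff_toReal_le h (ENNReal.toReal_nonneg.trans ht)).2 ht) r

end General

/-! ### Rigidity and the real-variable optimization -/

/-- The function `c - f` is nonnegative with integral zero. This turns tight capacity bounds into
pointwise values of an allocation. -/
theorem ae_eq_const_of_integral_ge {f : ℝ → ℝ} {a b c : ℝ} (hab : a ≤ b)
    (hf : IntervalIntegrable f volume a b) (hle : ∀ t, a ≤ t → f t ≤ c)
    (hint : c * (b - a) ≤ ∫ t in a..b, f t) :
    ∀ᵐ t, a < t → t ≤ b → f t = c := by
  have h0 : 0 ≤ᵐ[volume.restrict (Set.Ioc a b)] fun t => c - f t :=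
    (ae_restrict_iff' measurableSet_Ioc).2
      (Filter.Eventually.of_forall fun t ht => sub_nonneg.2 (hle t ht.1.le))
  have hi : IntervalIntegrable (fun t => c - f t) volume a b := intervalIntegrable_const.sub hf
  have hz : ∫ t in a..b, (c - f t) = 0 := by
    refine le_antisymm ?_
      (intervalIntegral.integral_nonneg hab fun t ht => sub_nonneg.2 (hle t ht.1))
    rw [intervalIntegral.integral_sub intervalIntegrable_const hf]
    simp only [intervalIntegral.integral_const, smul_eq_mul]
    linarith
  have h1 := (intervalIntegral.integral_eq_zero_iff_of_le_of_nonneg_ae hab h0 hi).1 hz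
  have h2 := (ae_restrict_iff' measurableSet_Ioc).1 h1
  filter_upwards [h2] with t ht h3 h4
  have := ht ⟨h3, h4⟩
  simp only [Pi.zero_apply] at this
  linarith

theorem eq_and_eq_of_mul_le_mul {a b x y : ℝ} (ha : 0 < a) (hb : 0 < b) (hx : a ≤ x)
    (hy : b ≤ y) (h : x * y ≤ a * b) : x = a ∧ y = b := by
  constructor
  · by_contra hne
    exact h.not_gt (mul_lt_mul (lt_of_le_of_ne hx (Ne.symm hne)) hy hb (ha.le.trans hx))
  · by_contra hne
    exact h.not_gt (mul_lt_mul' hx (lt_of_le_of_ne hy (Ne.symm hne)) hb.le (ha.trans_le hx))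

/-- The cost product of three agents with cumulative work `X`, `Y`, `Z` sharing two resources. -/
theorem envy_costProduct_bound {ε k : ℝ} (hε : 0 < ε) (hε1 : ε < 1) (hk : 2 < k)
    (hkε : ε * k < 2 - 3 * ε - ε ^ 2) {X Y Z : ℝ → ℝ}
    (hX0 : X 0 = 0) (hY0 : Y 0 = 0) (hZ0 : Z 0 = 0)
    (hX : ∀ a b, 0 ≤ a → a ≤ b → X a ≤ X b) (hY : ∀ a b, 0 ≤ a → a ≤ b → Y a ≤ Y b)
    (hZ : ∀ a b, 0 ≤ a → a ≤ b → Z a ≤ Z b)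
    (h1 : ∀ a b, 0 ≤ a → a ≤ b → (X b - X a) + (Y b - Y a) + ε * (Z b - Z a) ≤ b - a)
    (h2 : ∀ a b, 0 ≤ a → a ≤ b → (X b - X a) + ε * (Y b - Y a) + (Z b - Z a) ≤ b - a)
    {T₁ T₂ T₃ : ℝ} (hT₁ : 0 ≤ T₁) (hT₂ : 0 ≤ T₂) (hT₃ : 0 ≤ T₃)
    (hXT : 1 ≤ X T₁) (hYT : 1 ≤ Y T₂) (hZT : k ≤ Z T₃) :
    (2 + ε) * (1 + ε + k) ≤ T₁ * T₂ * T₃ ∧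
      (T₁ * T₂ * T₃ ≤ (2 + ε) * (1 + ε + k) →
        T₁ = 1 ∧ T₂ = 2 + ε ∧ T₃ = 1 + ε + k ∧ Z (2 + ε) = 1) := by
  have n1 : ∀ t, 0 ≤ t → X t + Y t + ε * Z t ≤ t := fun t ht => by
    have := h1 0 t le_rfl ht; rw [hX0, hY0, hZ0] at this; linarith
  have n2 : ∀ t, 0 ≤ t → X t + ε * Y t + Z t ≤ t := fun t ht => by
    have := h2 0 t le_rfl ht; rw [hX0, hY0, hZ0] at this; linarith
  have pX : ∀ t, 0 ≤ t → 0 ≤ X t := fun t ht => hX0 ▸ hX 0 t le_rfl ht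
  have pY : ∀ t, 0 ≤ t → 0 ≤ Y t := fun t ht => hY0 ▸ hY 0 t le_rfl ht
  have pZ : ∀ t, 0 ≤ t → 0 ≤ Z t := fun t ht => hZ0 ▸ hZ 0 t le_rfl ht
  have eY : ∀ t, 0 ≤ t → 0 ≤ ε * Y t := fun t ht => mul_nonneg hε.le (pY t ht)
  have eZ : ∀ t, 0 ≤ t → 0 ≤ ε * Z t := fun t ht => mul_nonneg hε.le (pZ t ht)
  have l1 : 1 ≤ T₁ := by linarith [n1 T₁ hT₁, pY T₁ hT₁, eZ T₁ hT₁]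
  have l2 : 1 ≤ T₂ := by linarith [n1 T₂ hT₂, pX T₂ hT₂, eZ T₂ hT₂]
  have l3 : k ≤ T₃ := by linarith [n2 T₃ hT₃, pX T₃ hT₃, eY T₃ hT₃]
  set M := max T₁ T₂ with hM
  set y := min T₁ T₂ with hy
  have hMy : T₁ * T₂ = y * M := (min_mul_max T₁ T₂).symm
  have hM1 : T₁ ≤ M := le_max_left _ _
  have hM2 : T₂ ≤ M := le_max_right _ _
  have hM0 : 0 ≤ M := hT₁.trans hM1
  have hXM : 1 ≤ X M := hXT.trans (hX _ _ hT₁ hM1)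
  have hYM : 1 ≤ Y M := hYT.trans (hY _ _ hT₂ hM2)
  have ly : 1 ≤ y := le_min l1 l2
  rw [hMy]
  rcases lt_or_ge T₃ M with hlt | hge
  -- If agent 3 is not last, all work is done by `M`, so `M` is at least the total demand `1 + ε +
  -- k` for the second resource. The other two finishing times already have product above `2 + ε`.
  · have hZM : k ≤ Z M := hZT.trans (hZ _ _ hT₃ hlt.le)
    have hMW : 1 + ε + k ≤ M := by nlinarith [n2 M hM0]
    have hyT : 2 + ε < y * T₃ := by
      rcases le_or_gt y T₃ with h | h
      · have : 2 + ε < T₃ := by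
          rcases min_le_iff.1 h with h | h
          · linarith [n2 T₃ hT₃, hX _ _ hT₁ h, eY T₃ hT₃]
          · nlinarith [n2 T₃ hT₃, hY _ _ hT₂ h, pX T₃ hT₃]
        calc 2 + ε < 1 * T₃ := by linarith
          _ ≤ y * T₃ := by gcongr
      · calc 2 + ε < 2 * 2 := by linarith
          _ ≤ y * T₃ := by gcongr <;> linarith
    have : (2 + ε) * (1 + ε + k) < y * M * T₃ := by
      have := mul_lt_mul' hMW hyT (by linarith) (by linarith)
      linarith
    exact ⟨this.le, fun h => absurd h this.not_ge⟩
  · have hX3 : 1 ≤ X T₃ := hXM.trans (hX _ _ hM0 hge)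
    have hY3 : 1 ≤ Y T₃ := hYM.trans (hY _ _ hM0 hge)
    have hW : 1 + ε + k ≤ T₃ := by nlinarith [n2 T₃ hT₃]
    have hMx : 2 + ε * Z M ≤ M := by linarith [n1 M hM0]
    -- After `M`, agent 3 still has `k - Z M` to do, at rate at most 1.
    have hT3x : M + k - Z M ≤ T₃ := by
      have := h2 M T₃ hM0 hge
      have := hX M T₃ hM0 hge
      have := mul_le_mul_of_nonneg_left (hY M T₃ hM0 hge) hε.le
      linarith
    have hx0 := pZ M hM0
    have key : (2 + ε) * (1 + ε + k) ≤ M * T₃ ∧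
        (M * T₃ ≤ (2 + ε) * (1 + ε + k) → M = 2 + ε ∧ T₃ = 1 + ε + k ∧ Z M = 1) := by
      generalize Z M = x at *
      rcases lt_or_ge x 1 with hx | hx
      · have a1 : 2 + k - (1 - ε) * x ≤ T₃ := by linarith
        have a2 : (2 + ε * x) * (2 + k - (1 - ε) * x) ≤ M * T₃ := by
          apply mul_le_mul hMx a1 _ hM0
          nlinarith
        have a3 : (2 + ε) * (1 + ε + k) < (2 + ε * x) * (2 + k - (1 - ε) * x) := by
          -- The difference vanishes at `x = 1`. After `1 - x` is factored out, the upper bound on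
          -- `k` is exactly what makes the first term positive.
          have : (2 + ε * x) * (2 + k - (1 - ε) * x) - (2 + ε) * (1 + ε + k) =
            (1 - x) * (2 - 3 * ε - ε ^ 2 - ε * k) + ε * (1 - ε) * (x * (1 - x)) := by ring
          have b1 : 0 < (1 - x) * (2 - 3 * ε - ε ^ 2 - ε * k) :=
            mul_pos (by linarith) (by linarith)
          have b2 : 0 ≤ ε * (1 - ε) * (x * (1 - x)) :=
            mul_nonneg (mul_nonneg hε.le (by linarith)) (mul_nonneg hx0 (by linarith))
          linarith
        exact ⟨by linarith, fun h => by linarith⟩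
      · have a1 : 2 + ε ≤ M := by nlinarith
        refine ⟨mul_le_mul a1 hW (by linarith) hM0, fun h => ?_⟩
        obtain ⟨b1, b2⟩ :=
          eq_and_eq_of_mul_le_mul (by linarith) (by linarith) a1 hW h
        refine ⟨b1, b2, le_antisymm ?_ hx⟩
        have : ε * x ≤ ε * 1 := by linarith
        exact le_of_mul_le_mul_left this hε
    have hMT0 : 0 < M * T₃ := mul_pos (by linarith) (by linarith)
    have hyMT : M * T₃ ≤ y * M * T₃ := by
      rw [mul_assoc]
      exact le_mul_of_one_le_left hMT0.le ly
    refine ⟨key.1.trans hyMT, fun h => ?_⟩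
    obtain ⟨c1, c2, c3⟩ := key.2 (hyMT.trans h)
    have hy1 : y = 1 :=
      (eq_and_eq_of_mul_le_mul one_pos (mul_pos (by linarith) (by linarith)) ly key.1
        (by rw [one_mul, ← mul_assoc]; exact h)).1
    rw [c1] at c3
    rcases min_choice T₁ T₂ with h' | h'
    · have t1 : T₁ = 1 := by rw [← h', ← hy, hy1]
      have t2 : T₂ = 2 + ε := by
        rcases max_choice T₁ T₂ with g | g
        · rw [← hM, c1, t1] at g; linarith
        · rw [← g, ← hM, c1]
      exact ⟨t1, t2, c2, c3⟩
    -- If agent 2 finished at time 1, it would have used all of the first resource until then, so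
    -- agents 1 and 3 would have done nothing. Both would need a unit of the second resource during
    -- `[1, 2 + ε]`, which has length `1 + ε < 2`.
    · have t2 : T₂ = 1 := by rw [← h', ← hy, hy1]
      exfalso
      rw [t2] at hYT
      rw [c1] at hXM
      have e1 := n1 1 zero_le_one
      have e2 := pX 1 zero_le_one
      have e3 := pZ 1 zero_le_one
      have e4 := h2 1 (2 + ε) zero_le_one (by linarith)
      have e5 := mul_nonneg hε.le (sub_nonneg.2 (hY 1 (2 + ε) zero_le_one (by linarith)))
      have e8 := eZ 1 zero_le_one
      have e6 : X 1 = 0 := by linarith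
      have e7 : Z 1 = 0 :=
        le_antisymm (le_of_mul_le_mul_left (by linarith) hε) e3
      linarith

/-! ### The three-agent problem -/

section Envy

variable {ε k : ℝ} {hε : 0 < ε} {hε1 : ε < 1} {hk : 2 < k}
  (A : Allocation (envyProblem ε k hε hε1 hk))

theorem envyProblem_toFun_zero {t : ℝ} (ht : 0 ≤ t) : A.toFun t 0 1 = A.toFun t 0 0 := by
  obtain ⟨l, -, h⟩ := (A.feasible t ht).2 0
  rw [h, h]; simp [envyProblem]

theorem envyProblem_toFun_one {t : ℝ} (ht : 0 ≤ t) : A.toFun t 1 1 = ε * A.toFun t 1 0 := by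
  obtain ⟨l, -, h⟩ := (A.feasible t ht).2 1
  rw [h, h]; simp [envyProblem, mul_comm]

theorem envyProblem_toFun_two {t : ℝ} (ht : 0 ≤ t) : A.toFun t 2 0 = ε * A.toFun t 2 1 := by
  obtain ⟨l, -, h⟩ := (A.feasible t ht).2 2
  rw [h, h]; simp [envyProblem, mul_comm]

theorem envyProblem_rate_le₁ {t : ℝ} (ht : 0 ≤ t) :
    A.toFun t 0 0 + A.toFun t 1 0 + ε * A.toFun t 2 1 ≤ 1 := by
  have := (A.feasible t ht).1 0
  rwa [Fin.sum_univ_three, envyProblem_toFun_two A ht] at this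

theorem envyProblem_rate_le₂ {t : ℝ} (ht : 0 ≤ t) :
    A.toFun t 0 0 + ε * A.toFun t 1 0 + A.toFun t 2 1 ≤ 1 := by
  have := (A.feasible t ht).1 1
  rwa [Fin.sum_univ_three, envyProblem_toFun_zero A ht, envyProblem_toFun_one A ht] at this

theorem envyProblem_integral_zero {a b : ℝ} (ha : 0 ≤ a) (hab : a ≤ b) :
    ∫ t in a..b, A.toFun t 0 1 = ∫ t in a..b, A.toFun t 0 0 := by
  refine intervalIntegral.integral_congr fun t ht => ?_
  rw [Set.uIcc_of_le hab] at ht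
  exact envyProblem_toFun_zero A (ha.trans ht.1)

theorem envyProblem_integral_one {a b : ℝ} (ha : 0 ≤ a) (hab : a ≤ b) :
    ∫ t in a..b, A.toFun t 1 1 = ε * ∫ t in a..b, A.toFun t 1 0 := by
  rw [← intervalIntegral.integral_const_mul]
  refine intervalIntegral.integral_congr fun t ht => ?_
  rw [Set.uIcc_of_le hab] at ht
  exact envyProblem_toFun_one A (ha.trans ht.1)

theorem envyProblem_integral_two {a b : ℝ} (ha : 0 ≤ a) (hab : a ≤ b) :
    ∫ t in a..b, A.toFun t 2 0 = ε * ∫ t in a..b, A.toFun t 2 1 := by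
  rw [← intervalIntegral.integral_const_mul]
  refine intervalIntegral.integral_congr fun t ht => ?_
  rw [Set.uIcc_of_le hab] at ht
  exact envyProblem_toFun_two A (ha.trans ht.1)

theorem envyProblem_integral_le₁ {a b : ℝ} (ha : 0 ≤ a) (hab : a ≤ b) :
    (∫ t in a..b, A.toFun t 0 0) + (∫ t in a..b, A.toFun t 1 0) +
      ε * (∫ t in a..b, A.toFun t 2 1) ≤ b - a := by
  have := A.sum_integral_le ha hab 0
  rwa [Fin.sum_univ_three, envyProblem_integral_two A ha hab] at this

theorem envyProblem_integral_le₂ {a b : ℝ} (ha : 0 ≤ a) (hab : a ≤ b) :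
    (∫ t in a..b, A.toFun t 0 0) + ε * (∫ t in a..b, A.toFun t 1 0) +
      (∫ t in a..b, A.toFun t 2 1) ≤ b - a := by
  have := A.sum_integral_le ha hab 1
  rwa [Fin.sum_univ_three, envyProblem_integral_zero A ha hab,
    envyProblem_integral_one A ha hab] at this

theorem envyProblem_cost_zero_le_iff {t : ℝ} (ht : 0 ≤ t) :
    (envyProblem ε k hε hε1 hk).cost 0 (A.bundle 0) ≤ ENNReal.ofReal t ↔
      1 ≤ ∫ s in (0 : ℝ)..t, A.toFun s 0 0 := by
  rw [A.cost_le_iff 0 0 ht, Fin.forall_fin_two, envyProblem_integral_zero A le_rfl ht]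
  simp [envyProblem]

theorem envyProblem_cost_one_le_iff {t : ℝ} (ht : 0 ≤ t) :
    (envyProblem ε k hε hε1 hk).cost 1 (A.bundle 1) ≤ ENNReal.ofReal t ↔
      1 ≤ ∫ s in (0 : ℝ)..t, A.toFun s 1 0 := by
  rw [A.cost_le_iff 1 1 ht, Fin.forall_fin_two, envyProblem_integral_one A le_rfl ht]
  simp [envyProblem, hε]

theorem envyProblem_cost_two_le_iff {t : ℝ} (ht : 0 ≤ t) :
    (envyProblem ε k hε hε1 hk).cost 2 (A.bundle 2) ≤ ENNReal.ofReal t ↔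
      k ≤ ∫ s in (0 : ℝ)..t, A.toFun s 2 1 := by
  rw [A.cost_le_iff 2 2 ht, Fin.forall_fin_two, envyProblem_integral_two A le_rfl ht]
  simp [envyProblem, mul_comm k, hε]

theorem envyProblem_cost_one_bundle_zero (h : 1 ≤ ∫ s in (0 : ℝ)..1, A.toFun s 0 0) :
    (envyProblem ε k hε hε1 hk).cost 1 (A.bundle 0) = ENNReal.ofReal 1 := by
  refine le_antisymm ?_ (A.k_le_cost 1 0)
  rw [A.cost_le_iff 1 0 zero_le_one, Fin.forall_fin_two,
    envyProblem_integral_zero A le_rfl zero_le_one]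
  simp only [envyProblem, Fin.isValue, Matrix.cons_val_one, Matrix.cons_val_zero, Matrix.of_apply,
    Matrix.cons_val', Matrix.cons_val_fin_one, one_mul]
  exact ⟨h, hε1.le.trans h⟩

/-- The allocation completes the work as fast as the envy schedule. -/
def EnvyOptimal : Prop :=
  1 ≤ (∫ s in (0 : ℝ)..1, A.toFun s 0 0) ∧ 1 ≤ (∫ s in (0 : ℝ)..(2 + ε), A.toFun s 1 0) ∧
    k ≤ (∫ s in (0 : ℝ)..(1 + ε + k), A.toFun s 2 1) ∧
    (∫ s in (0 : ℝ)..(2 + ε), A.toFun s 2 1) = 1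

theorem envyProblem_costProduct_bound (hkε : k < 2 / ε - 3 - ε) :
    ENNReal.ofReal ((2 + ε) * (1 + ε + k)) ≤ A.costProduct ∧
      (A.costProduct ≤ ENNReal.ofReal ((2 + ε) * (1 + ε + k)) →
        (envyProblem ε k hε hε1 hk).cost 0 (A.bundle 0) = ENNReal.ofReal 1 ∧
        (envyProblem ε k hε hε1 hk).cost 1 (A.bundle 1) = ENNReal.ofReal (2 + ε) ∧
        (envyProblem ε k hε hε1 hk).cost 2 (A.bundle 2) = ENNReal.ofReal (1 + ε + k) ∧
        EnvyOptimal A) := by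
  by_cases htop : A.costProduct = ⊤
  · simp [htop]
  have hfin := A.cost_ne_top_of_costProduct_ne_top htop
  obtain ⟨T₁, h₁⟩ : ∃ T, T = ((envyProblem ε k hε hε1 hk).cost 0 (A.bundle 0)).toReal := ⟨_, rfl⟩
  obtain ⟨T₂, h₂⟩ : ∃ T, T = ((envyProblem ε k hε hε1 hk).cost 1 (A.bundle 1)).toReal := ⟨_, rfl⟩
  obtain ⟨T₃, h₃⟩ : ∃ T, T = ((envyProblem ε k hε hε1 hk).cost 2 (A.bundle 2)).toReal := ⟨_, rfl⟩
  have p₁ : 0 ≤ T₁ := h₁ ▸ ENNReal.toReal_nonneg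
  have p₂ : 0 ≤ T₂ := h₂ ▸ ENNReal.toReal_nonneg
  have p₃ : 0 ≤ T₃ := h₃ ▸ ENNReal.toReal_nonneg
  have c₁ : (envyProblem ε k hε hε1 hk).cost 0 (A.bundle 0) = ENNReal.ofReal T₁ := by
    rw [h₁, ENNReal.ofReal_toReal (hfin 0)]
  have c₂ : (envyProblem ε k hε hε1 hk).cost 1 (A.bundle 1) = ENNReal.ofReal T₂ := by
    rw [h₂, ENNReal.ofReal_toReal (hfin 1)]
  have c₃ : (envyProblem ε k hε hε1 hk).cost 2 (A.bundle 2) = ENNReal.ofReal T₃ := by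
    rw [h₃, ENNReal.ofReal_toReal (hfin 2)]
  have w₁ := (envyProblem_cost_zero_le_iff A p₁).1 c₁.le
  have w₂ := (envyProblem_cost_one_le_iff A p₂).1 c₂.le
  have w₃ := (envyProblem_cost_two_le_iff A p₃).1 c₃.le
  have hprod : A.costProduct = ENNReal.ofReal (T₁ * T₂ * T₃) := by
    rw [Allocation.costProduct, Fin.prod_univ_three, c₁, c₂, c₃,
      ENNReal.ofReal_mul (mul_nonneg p₁ p₂), ENNReal.ofReal_mul p₁]
  have hkε' : ε * k < 2 - 3 * ε - ε ^ 2 := by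
    have := mul_lt_mul_of_pos_left hkε hε
    have e : ε * (2 / ε - 3 - ε) = 2 - 3 * ε - ε ^ 2 := by field_simp
    linarith
  have hmono : ∀ (i : Fin 3) (r : Fin 2) (a b : ℝ), 0 ≤ a → a ≤ b →
      (∫ s in (0 : ℝ)..a, A.toFun s i r) ≤ ∫ s in (0 : ℝ)..b, A.toFun s i r := by
    intro i r a b ha hab
    linarith [A.integral_add le_rfl ha (ha.trans hab) i r, A.integral_nonneg ha hab i r]
  have hsub : ∀ (i : Fin 3) (r : Fin 2) (a b : ℝ), 0 ≤ a → a ≤ b →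
      (∫ s in (0 : ℝ)..b, A.toFun s i r) - (∫ s in (0 : ℝ)..a, A.toFun s i r) =
        ∫ s in a..b, A.toFun s i r := by
    intro i r a b ha hab
    linarith [A.integral_add le_rfl ha (ha.trans hab) i r]
  -- The chosen coordinates `(0, 0)`, `(1, 0)`, `(2, 1)` have demand 1, so their integrals are the
  -- amounts of work done.
  have key := envy_costProduct_bound hε hε1 hk hkε'
    (X := fun t => ∫ s in (0 : ℝ)..t, A.toFun s 0 0)
    (Y := fun t => ∫ s in (0 : ℝ)..t, A.toFun s 1 0)
    (Z := fun t => ∫ s in (0 : ℝ)..t, A.toFun s 2 1)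
    intervalIntegral.integral_same intervalIntegral.integral_same intervalIntegral.integral_same
    (hmono 0 0) (hmono 1 0) (hmono 2 1)
    (fun a b ha hab => by
      simp only [hsub _ _ a b ha hab]; exact envyProblem_integral_le₁ A ha hab)
    (fun a b ha hab => by
      simp only [hsub _ _ a b ha hab]; exact envyProblem_integral_le₂ A ha hab)
    p₁ p₂ p₃ w₁ w₂ w₃
  rw [hprod]
  refine ⟨ENNReal.ofReal_le_ofReal key.1, fun h => ?_⟩
  obtain ⟨e₁, e₂, e₃, e₄⟩ := key.2 ((ENNReal.ofReal_le_ofReal_iff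
    (mul_nonneg (by linarith) (by linarith))).1 h)
  subst e₁ e₂ e₃
  exact ⟨c₁, c₂, c₃, w₁, w₂, w₃, e₄⟩

theorem envyProblem_costProduct_le (h : 1 ≤ (∫ s in (0 : ℝ)..1, A.toFun s 0 0) ∧
      1 ≤ (∫ s in (0 : ℝ)..(2 + ε), A.toFun s 1 0) ∧
      k ≤ (∫ s in (0 : ℝ)..(1 + ε + k), A.toFun s 2 1)) :
    A.costProduct ≤ ENNReal.ofReal ((2 + ε) * (1 + ε + k)) := by
  rw [Allocation.costProduct, Fin.prod_univ_three, ← one_mul ((2 + ε) * (1 + ε + k)), ← mul_assoc,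
    ENNReal.ofReal_mul (by linarith), ENNReal.ofReal_mul zero_le_one]
  exact mul_le_mul' (mul_le_mul' ((envyProblem_cost_zero_le_iff A zero_le_one).2 h.1)
    ((envyProblem_cost_one_le_iff A (by linarith)).2 h.2.1))
    ((envyProblem_cost_two_le_iff A (by linarith)).2 h.2.2)

/-- Agent 1 fills `[0, 1]`, so the first units of work of agents 2 and 3 both fall in `[1, 2 + ε]`.
They exhaust both resources there, and the remaining `k - 1` of agent 3 exactly fills the rest of
the time. -/
theorem EnvyOptimal.ae_eq (h : EnvyOptimal A) :
    ∀ᵐ t : ℝ, 0 ≤ t → t < 1 + ε + k → A.toFun t = envySchedule ε t := by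
  obtain ⟨h1, h2, h3, h4⟩ := h
  have hε0 : 0 ≤ 2 + ε := by linarith
  have h12 : (1 : ℝ) ≤ 2 + ε := by linarith
  have h2k : 2 + ε ≤ 1 + ε + k := by linarith
  have a1 := A.integral_add le_rfl zero_le_one hε0 0 0
  have a2 := A.integral_add le_rfl zero_le_one hε0 1 0
  have a3 := A.integral_add le_rfl zero_le_one hε0 2 1
  have a4 := A.integral_add le_rfl hε0 (hε0.trans h2k) 2 1
  have n2 := A.integral_nonneg le_rfl zero_le_one 1 0
  have n3 := A.integral_nonneg le_rfl zero_le_one 2 1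
  have n4 := A.integral_nonneg zero_le_one h12 0 0
  have s1 := envyProblem_integral_le₁ A le_rfl zero_le_one
  have s2 := envyProblem_integral_le₂ A le_rfl zero_le_one
  have m3 := mul_nonneg hε.le n3
  have z2 : ∫ t in (0 : ℝ)..1, A.toFun t 1 0 = 0 := by linarith
  have z3 : ∫ t in (0 : ℝ)..1, A.toFun t 2 1 = 0 := by
    rw [z2] at s2; linarith
  have y2 : 1 ≤ ∫ t in (1 : ℝ)..(2 + ε), A.toFun t 1 0 := by linarith
  have y3 : ∫ t in (1 : ℝ)..(2 + ε), A.toFun t 2 1 = 1 := by linarith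
  have u1 := envyProblem_integral_le₁ A zero_le_one h12
  rw [y3] at u1
  have i0 := A.intervalIntegrable zero_le_one hε0 0 0
  have i1 := A.intervalIntegrable zero_le_one hε0 1 0
  have i2 := A.intervalIntegrable zero_le_one hε0 2 1
  have b1 := ae_eq_const_of_integral_ge (c := 1) zero_le_one
    (A.intervalIntegrable le_rfl zero_le_one 0 0) (fun t ht => A.toFun_le_one ht 0 0) (by linarith)
  have b2 := ae_eq_const_of_integral_ge (c := 0) h12 i0.neg
    (fun t ht => by simpa using A.toFun_nonneg (zero_le_one.trans ht) 0 0) (by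
      simp only [Pi.neg_apply, intervalIntegral.integral_neg]; linarith)
  have b3 := ae_eq_const_of_integral_ge (c := 1)
    (f := fun t => A.toFun t 0 0 + A.toFun t 1 0 + ε * A.toFun t 2 1) h12
    ((i0.add i1).add (i2.const_mul ε))
    (fun t ht => envyProblem_rate_le₁ A (zero_le_one.trans ht)) (by
      rw [intervalIntegral.integral_add (i0.add i1) (i2.const_mul ε),
        intervalIntegral.integral_add i0 i1, intervalIntegral.integral_const_mul, y3]
      linarith)
  have b4 := ae_eq_const_of_integral_ge (c := 1)
    (f := fun t => A.toFun t 0 0 + ε * A.toFun t 1 0 + A.toFun t 2 1) h12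
    ((i0.add (i1.const_mul ε)).add i2)
    (fun t ht => envyProblem_rate_le₂ A (zero_le_one.trans ht)) (by
      rw [intervalIntegral.integral_add (i0.add (i1.const_mul ε)) i2,
        intervalIntegral.integral_add i0 (i1.const_mul ε), intervalIntegral.integral_const_mul, y3]
      have := mul_le_mul_of_nonneg_left y2 hε.le
      linarith)
  have b5 := ae_eq_const_of_integral_ge (c := 1) h2k
    (A.intervalIntegrable hε0 (hε0.trans h2k) 2 1)
    (fun t ht => A.toFun_le_one (hε0.trans ht) 2 1) (by linarith)
  -- The rigidity statements hold on intervals `(a, b]`, whereas the schedule switches at left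
  -- endpoints.
  have hne : ∀ x : ℝ, ∀ᵐ t : ℝ, t ≠ x := fun x => Measure.ae_ne volume x
  filter_upwards [b1, b2, b3, b4, b5, hne 0, hne 1, hne (2 + ε)] with
    t b1 b2 b3 b4 b5 t0 t1 t2 ht0 htW
  have r1 := envyProblem_rate_le₁ A ht0
  have r2 := envyProblem_rate_le₂ A ht0
  have p1 := A.toFun_nonneg ht0 0 0
  have p2 := A.toFun_nonneg ht0 1 0
  have p3 := A.toFun_nonneg ht0 2 1
  have q2 := mul_nonneg hε.le p2
  have q3 := mul_nonneg hε.le p3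
  have e0 := envyProblem_toFun_zero A ht0
  have e1 := envyProblem_toFun_one A ht0
  have e2 := envyProblem_toFun_two A ht0
  have hext : ∀ x y z : ℝ, A.toFun t 0 0 = x → A.toFun t 1 0 = y → A.toFun t 2 1 = z →
      A.toFun t = !![x, x; y, ε * y; ε * z, z] := by
    intro x y z hx hy hz
    ext i r
    fin_cases i <;> fin_cases r <;> simp [e0, e1, e2, hx, hy, hz]
  unfold envySchedule
  split_ifs with c1 c2
  · have := b1 (lt_of_le_of_ne ht0 t0.symm) c1.le
    rw [hext 1 0 0 this (by linarith) (by nlinarith)]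
    simp
  · have l1 := lt_of_le_of_ne (not_lt.1 c1) t1.symm
    have x0 : A.toFun t 0 0 = 0 := by simpa using b2 l1 c2.le
    have f1 := b3 l1 c2.le
    have f2 := b4 l1 c2.le
    rw [x0] at f1 f2
    -- Subtract the two saturated capacity constraints.
    have hyz : A.toFun t 1 0 = A.toFun t 2 1 := by
      have : (1 - ε) * (A.toFun t 1 0 - A.toFun t 2 1) = 0 := by linarith
      rcases mul_eq_zero.1 this with h | h <;> linarith
    have hy : A.toFun t 1 0 = 1 / (1 + ε) := by
      rw [eq_div_iff (by linarith)]; rw [← hyz] at f1; linarith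
    rw [hext 0 _ _ x0 hy (hyz ▸ hy)]
    simp [div_eq_mul_inv]
  · have := b5 (lt_of_le_of_ne (not_lt.1 c2) t2.symm) htW.le
    rw [hext 0 0 1 (by linarith) (by nlinarith) this]
    simp

theorem envyProblem_integral_ge_of_ae_eq
    (h : ∀ᵐ t : ℝ, 0 ≤ t → t < 1 + ε + k → A.toFun t = envySchedule ε t) :
    1 ≤ (∫ s in (0 : ℝ)..1, A.toFun s 0 0) ∧ 1 ≤ (∫ s in (0 : ℝ)..(2 + ε), A.toFun s 1 0) ∧
    k ≤ (∫ s in (0 : ℝ)..(1 + ε + k), A.toFun s 2 1) := by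
  have hε0 : 0 ≤ 2 + ε := by linarith
  have h12 : (1 : ℝ) ≤ 2 + ε := by linarith
  have h2k : 2 + ε ≤ 1 + ε + k := by linarith
  have hint : ∀ (i : Fin 3) (r : Fin 2) (a b c : ℝ), 0 ≤ a → a ≤ b → b ≤ 1 + ε + k →
      (∀ t, a ≤ t → t < b → envySchedule ε t i r = c) →
      ∫ t in a..b, A.toFun t i r = (b - a) * c := by
    intro i r a b c ha hab hb hc
    rw [← smul_eq_mul, ← intervalIntegral.integral_const]
    refine intervalIntegral.integral_congr_ae ?_
    filter_upwards [h, Measure.ae_ne volume b] with t ht htb hm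
    rw [Set.uIoc_of_le hab] at hm
    have hlt := lt_of_le_of_ne hm.2 htb
    rw [ht (ha.trans hm.1.le) (hlt.trans_le hb), hc t hm.1.le hlt]
  have mid : ∀ t, 1 ≤ t → t < 2 + ε → envySchedule ε t = !![0, 0; 1 / (1 + ε), ε / (1 + ε);
      ε / (1 + ε), 1 / (1 + ε)] := fun t h1 h2 => by
    unfold envySchedule; rw [if_neg h1.not_gt, if_pos h2]
  have x1 := hint 0 0 0 1 1 le_rfl zero_le_one (by linarith) fun t _ ht => by
    simp [envySchedule, ht]
  have y1 := hint 1 0 1 (2 + ε) (1 / (1 + ε)) zero_le_one h12 h2k fun t h1 h2 => by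
    simp [mid t h1 h2]
  have z1 := hint 2 1 1 (2 + ε) (1 / (1 + ε)) zero_le_one h12 h2k fun t h1 h2 => by
    simp [mid t h1 h2]
  have z2 := hint 2 1 (2 + ε) (1 + ε + k) 1 hε0 h2k le_rfl fun t h1 _ => by
    simp [envySchedule, (h12.trans h1).not_gt, h1.not_gt]
  have e : (2 + ε - 1) * (1 / (1 + ε)) = 1 := by
    have : 1 + ε ≠ 0 := by linarith
    rw [mul_one_div, div_eq_one_iff_eq this]; ring
  rw [e] at y1 z1
  refine ⟨by linarith, ?_, ?_⟩
  · linarith [A.integral_add le_rfl zero_le_one hε0 1 0,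
      A.integral_nonneg le_rfl zero_le_one 1 0]
  · linarith [A.integral_add le_rfl zero_le_one hε0 2 1,
      A.integral_nonneg le_rfl zero_le_one 2 1, A.integral_add le_rfl hε0 (hε0.trans h2k) 2 1]

end Envy

/-- The envy schedule as an allocation. -/
noncomputable def envyAllocation (ε k : ℝ) (hε : 0 < ε) (hε1 : ε < 1) (hk : 2 < k) :
    Allocation (envyProblem ε k hε hε1 hk) where
  toFun := envySchedule ε
  measurable_toFun i r := by
    have : (fun t => envySchedule ε t i r) = fun t => if t < 1 then
        (!![1, 1; 0, 0; 0, 0] : Matrix (Fin 3) (Fin 2) ℝ) i r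
      else if t < 2 + ε then
        !![0, 0; 1 / (1 + ε), ε / (1 + ε); ε / (1 + ε), 1 / (1 + ε)] i r
      else !![0, 0; 0, 0; ε, 1] i r := by
      funext t
      unfold envySchedule
      split_ifs <;> rfl
    rw [this]
    exact Measurable.ite measurableSet_Iio measurable_const
      (Measurable.ite measurableSet_Iio measurable_const measurable_const)
  feasible t _ := by
    have hpos : 0 < 1 + ε := by linarith
    have hsum : (1 + ε)⁻¹ + ε / (1 + ε) = 1 := by field_simp
    unfold envySchedule
    split_ifs
    · refine ⟨fun r => ?_, fun i => ⟨![1, 0, 0] i, ?_, fun r => ?_⟩⟩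
      · fin_cases r <;> simp [Fin.sum_univ_three]
      · fin_cases i <;> simp
      · fin_cases i <;> fin_cases r <;> simp [envyProblem]
    · refine ⟨fun r => ?_, fun i => ⟨![0, 1 / (1 + ε), 1 / (1 + ε)] i, ?_, fun r => ?_⟩⟩
      · fin_cases r <;> simp [Fin.sum_univ_three] <;> linarith
      · fin_cases i <;> simp <;> positivity
      · fin_cases i <;> fin_cases r <;> simp [envyProblem, div_eq_inv_mul]
    · refine ⟨fun r => ?_, fun i => ⟨![0, 0, 1] i, ?_, fun r => ?_⟩⟩
      · fin_cases r <;> simp [Fin.sum_univ_three, hε1.le]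
      · fin_cases i <;> simp
      · fin_cases i <;> fin_cases r <;> simp [envyProblem]

theorem envyAllocation_costProduct_le (ε k : ℝ) (hε : 0 < ε) (hε1 : ε < 1) (hk : 2 < k) :
    (envyAllocation ε k hε hε1 hk).costProduct ≤ ENNReal.ofReal ((2 + ε) * (1 + ε + k)) :=
  envyProblem_costProduct_le _
    (envyProblem_integral_ge_of_ae_eq _ (Filter.Eventually.of_forall fun _ _ _ => rfl))

theorem envyProblem_isLCP_iff_costProduct_le {ε k : ℝ} {hε : 0 < ε} {hε1 : ε < 1} {hk : 2 < k}
    (hkε : k < 2 / ε - 3 - ε) (A : Allocation (envyProblem ε k hε hε1 hk)) :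
    A.IsLCP ↔ A.costProduct ≤ ENNReal.ofReal ((2 + ε) * (1 + ε + k)) :=
  ⟨fun h => (h _).trans (envyAllocation_costProduct_le ε k hε hε1 hk),
    fun h B => h.trans (envyProblem_costProduct_bound B hkε).1⟩

theorem envyProblem_isLCP_iff_ae_eq {ε k : ℝ} {hε : 0 < ε} {hε1 : ε < 1} {hk : 2 < k}
    (hkε : k < 2 / ε - 3 - ε) (A : Allocation (envyProblem ε k hε hε1 hk)) :
    A.IsLCP ↔ ∀ᵐ t : ℝ, 0 ≤ t → t < 1 + ε + k → A.toFun t = envySchedule ε t := by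
  rw [envyProblem_isLCP_iff_costProduct_le hkε]
  exact ⟨fun h => EnvyOptimal.ae_eq A ((envyProblem_costProduct_bound A hkε).2 h).2.2.2,
    fun h => envyProblem_costProduct_le A (envyProblem_integral_ge_of_ae_eq A h)⟩

/-- Some agent is envious in every LCP allocation, and there is an LCP allocation that completes
all work as early as the total demand for some resource `r` permits. -/
def Problem.ForcesEnvy {n m : ℕ} (I : Problem n m) : Prop :=
  (∀ i, 1 ≤ I.k i) ∧
  (∃ (r : Fin m) (A : Allocation I), A.IsLCP ∧ A.costProduct ≠ ⊤ ∧
    ∀ i r', I.k i * I.d i r' ≤ ∫ s in (0 : ℝ)..(∑ i, I.k i * I.d i r), A.toFun s i r') ∧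
  ∃ i j, ∀ A : Allocation I, A.IsLCP →
    I.cost i (A.bundle j) ≤ 1 ∧ 2 ≤ I.cost i (A.bundle i)

theorem envyProblem_forcesEnvy {ε k : ℝ} {hε : 0 < ε} {hε1 : ε < 1} {hk : 2 < k}
    (hkε : k < 2 / ε - 3 - ε) : (envyProblem ε k hε hε1 hk).ForcesEnvy := by
  set A := envyAllocation ε k hε hε1 hk
  have hA := envyAllocation_costProduct_le ε k hε hε1 hk
  have hLCP := (envyProblem_isLCP_iff_costProduct_le hkε A).2 hA
  have hcost := (envyProblem_costProduct_bound A hkε).2 hA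
  -- The second resource (index 1) is the bottleneck: its total demand `1 + ε + k` is the time at
  -- which agent 3 finishes, last of all.
  refine ⟨fun i => ?_, ⟨1, A, hLCP, (hA.trans_lt ENNReal.ofReal_lt_top).ne, fun i => ?_⟩,
    1, 0, fun B hB => ?_⟩
  · fin_cases i <;> simp [envyProblem]; linarith
  · have hW : ∑ i, (envyProblem ε k hε hε1 hk).k i * (envyProblem ε k hε hε1 hk).d i 1
        = 1 + ε + k := by
      simp [Fin.sum_univ_three, envyProblem]
    rw [hW]
    refine (A.cost_le_iff i i (by linarith)).1 ?_
    fin_cases i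
    · exact hcost.1.le.trans (ENNReal.ofReal_le_ofReal (by linarith))
    · exact hcost.2.1.le.trans (ENNReal.ofReal_le_ofReal (by linarith))
    · exact hcost.2.2.1.le
  · have h := (envyProblem_costProduct_bound B hkε).2
      ((envyProblem_isLCP_iff_costProduct_le hkε B).1 hB)
    rw [envyProblem_cost_one_bundle_zero B h.2.2.2.1, h.2.1]
    refine ⟨ENNReal.ofReal_one.le, ?_⟩
    rw [← ENNReal.ofReal_ofNat]
    exact ENNReal.ofReal_le_ofReal (by linarith)

/-! ### Duplicating resources -/

section Duplicate

variable {n m m' : ℕ} {f : Fin m' → Fin m}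

/-- Replace the resources by copies, each resource `r` being copied to the fibre of `f`. -/
def Problem.copyResources (I : Problem n m) (hf : f.Surjective) : Problem n m' where
  d i r := I.d i (f r)
  k := I.k
  d_nonneg i r := I.d_nonneg i (f r)
  d_le_one i r := I.d_le_one i (f r)
  exists_d_eq_one i := by
    obtain ⟨r, hr⟩ := I.exists_d_eq_one i
    obtain ⟨r', rfl⟩ := hf r
    exact ⟨r', hr⟩
  k_pos := I.k_pos

def Allocation.copyResources {I : Problem n m} (A : Allocation I) (hf : f.Surjective) :
    Allocation (I.copyResources hf) where
  toFun t i r := A.toFun t i (f r)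
  measurable_toFun i r := A.measurable_toFun i (f r)
  feasible t ht := ⟨fun r => (A.feasible t ht).1 (f r), fun i => by
    obtain ⟨l, hl, h⟩ := (A.feasible t ht).2 i
    exact ⟨l, hl, fun r => h (f r)⟩⟩

theorem Allocation.cost_copyResources {I : Problem n m} (A : Allocation I) (hf : f.Surjective)
    (i j : Fin n) : (I.copyResources hf).cost i ((A.copyResources hf).bundle j) =
      I.cost i (A.bundle j) := by
  unfold Problem.cost
  simp_rw [hf.forall (p := fun r => I.k i * I.d i r ≤ ∫ s in (0 : ℝ)..(_ : ℝ), A.bundle j s r)]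
  rfl

/-- Keep one copy of each resource. -/
noncomputable def Allocation.mergeResources {I : Problem n m} {hf : f.Surjective}
    (A : Allocation (I.copyResources hf)) : Allocation I where
  toFun t i r := A.toFun t i (Function.surjInv hf r)
  measurable_toFun i r := A.measurable_toFun i _
  feasible t ht := ⟨fun r => (A.feasible t ht).1 _, fun i => by
    obtain ⟨l, hl, h⟩ := (A.feasible t ht).2 i
    refine ⟨l, hl, fun r => ?_⟩
    refine (h _).trans ?_
    simp [Problem.copyResources, Function.surjInv_eq]⟩

/-- No information is lost by keeping one copy: a bundle is a multiple of a demand vector that is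
constant on the fibres of `f`. -/
theorem Allocation.cost_mergeResources {I : Problem n m} {hf : f.Surjective}
    (A : Allocation (I.copyResources hf)) (i j : Fin n) :
    I.cost i (A.mergeResources.bundle j) = (I.copyResources hf).cost i (A.bundle j) := by
  rw [← Allocation.cost_copyResources _ hf]
  unfold Problem.cost
  refine iInf_congr fun t => iInf_congr_Prop (forall_congr' fun r => ?_) fun _ => rfl
  have : ∫ s in (0 : ℝ)..t, (A.mergeResources.copyResources hf).bundle j s r =
      ∫ s in (0 : ℝ)..t, A.bundle j s r := by
    refine intervalIntegral.integral_congr fun s hs => ?_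
    rw [Set.uIcc_of_le (show (0 : ℝ) ≤ (t : ℝ) from t.2)] at hs
    obtain ⟨l, hl, h⟩ := (A.feasible s hs.1).2 j
    change A.toFun s j (Function.surjInv hf (f r)) = A.toFun s j r
    rw [h, h]
    simp [Problem.copyResources, Function.surjInv_eq]
  rw [this]

theorem Problem.ForcesEnvy.copyResources {I : Problem n m} (h : I.ForcesEnvy)
    (hf : f.Surjective) : (I.copyResources hf).ForcesEnvy := by
  obtain ⟨hk, ⟨r, A, hA, hfin, hW⟩, i, j, hij⟩ := h
  have hup : ∀ B : Allocation I, (B.copyResources hf).costProduct = B.costProduct := fun B =>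
    Finset.prod_congr rfl fun i _ => B.cost_copyResources hf i i
  have hdown : ∀ B : Allocation (I.copyResources hf),
      B.mergeResources.costProduct = B.costProduct := fun B =>
    Finset.prod_congr rfl fun i _ => B.cost_mergeResources i i
  obtain ⟨r', rfl⟩ := hf r
  refine ⟨hk, ⟨r', A.copyResources hf, fun B => ?_, ?_, fun i s => hW i (f s)⟩, i, j,
    fun B hB => ?_⟩
  · rw [hup, ← hdown]; exact hA _
  · rwa [hup]
  · rw [← B.cost_mergeResources, ← B.cost_mergeResources]
    exact hij _ fun C => by rw [hdown, ← hup]; exact hB _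

end Duplicate

/-! ### Adding an agent -/

section AddAgent

variable {n m : ℕ}

/-- Add an agent who needs all resources equally and has work `K`. -/
def Problem.addAgent (I : Problem n m) (r : Fin m) (K : ℝ) (hK : 0 < K) : Problem (n + 1) m where
  d := Matrix.of fun i s => Fin.cons (α := fun _ => ℝ) 1 (I.d · s) i
  k := Fin.cons K I.k
  d_nonneg := Fin.cases (by simp) (by simpa using I.d_nonneg)
  d_le_one := Fin.cases (by simp) (by simpa using I.d_le_one)
  exists_d_eq_one := Fin.cases ⟨r, by simp⟩ (by simpa using I.exists_d_eq_one)
  k_pos := Fin.cases (by simpa using hK) (by simpa using I.k_pos)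

variable {I : Problem n m} {r : Fin m} {K : ℝ} {hK : 0 < K}

/-- Forget the added agent. -/
def Allocation.removeAgent (B : Allocation (I.addAgent r K hK)) : Allocation I where
  toFun t i s := B.toFun t i.succ s
  measurable_toFun i s := B.measurable_toFun i.succ s
  feasible t ht := ⟨fun s => by
    have h := (B.feasible t ht).1 s
    rw [Fin.sum_univ_succ] at h
    linarith [B.toFun_nonneg ht 0 s], fun i => by
    simpa [Problem.addAgent] using (B.feasible t ht).2 i.succ⟩

theorem Allocation.cost_removeAgent (B : Allocation (I.addAgent r K hK)) (i j : Fin n) :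
    I.cost i (B.removeAgent.bundle j) = (I.addAgent r K hK).cost i.succ (B.bundle j.succ) := rfl

theorem Allocation.costProduct_removeAgent (B : Allocation (I.addAgent r K hK)) :
    B.costProduct = (I.addAgent r K hK).cost 0 (B.bundle 0) * B.removeAgent.costProduct := by
  unfold Allocation.costProduct
  rw [Fin.prod_univ_succ]
  rfl

/-- Serve the added agent from time `W` on. -/
noncomputable def Allocation.appendAgent (A : Allocation I) (r : Fin m) (K : ℝ) (hK : 0 < K)
    (W : ℝ) : Allocation (I.addAgent r K hK) where
  toFun t := Matrix.of fun i s => if t < W then Fin.cons (α := fun _ => ℝ) 0 (A.toFun t · s) i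
    else Fin.cons (α := fun _ => ℝ) 1 (fun _ => 0) i
  measurable_toFun i s := by
    refine Measurable.ite measurableSet_Iio ?_ measurable_const
    refine Fin.cases ?_ (fun i => ?_) i
    · simp
    · simpa using A.measurable_toFun i s
  feasible t ht := by
    obtain ⟨h1, h2⟩ := A.feasible t ht
    split_ifs
    · refine ⟨fun s => by simpa [Fin.sum_univ_succ] using h1 s, Fin.cases ⟨0, by simp⟩ fun i => ?_⟩
      simpa [Problem.addAgent] using h2 i
    · refine ⟨fun s => by simp [Fin.sum_univ_succ], Fin.cases ⟨1, by simp [Problem.addAgent]⟩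
        fun i => ⟨0, by simp⟩⟩

theorem Allocation.integral_appendAgent_succ (A : Allocation I) (r : Fin m) (K : ℝ) (hK : 0 < K)
    {W t : ℝ} (h0 : 0 ≤ t) (ht : t ≤ W) (i : Fin n) (s : Fin m) :
    ∫ u in (0 : ℝ)..t, (A.appendAgent r K hK W).toFun u i.succ s =
      ∫ u in (0 : ℝ)..t, A.toFun u i s := by
  refine intervalIntegral.integral_congr_ae ?_
  filter_upwards [Measure.ae_ne volume t] with u hu hm
  rw [Set.uIoc_of_le h0] at hm
  simp [Allocation.appendAgent, (lt_of_le_of_ne hm.2 hu).trans_le ht]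

theorem Allocation.integral_appendAgent_zero (A : Allocation I) (r : Fin m) (K : ℝ) (hK : 0 < K)
    {W : ℝ} (s : Fin m) :
    ∫ u in W..(K + W), (A.appendAgent r K hK W).toFun u 0 s = K := by
  have : ∫ u in W..(K + W), (A.appendAgent r K hK W).toFun u 0 s = ∫ u in W..(K + W), (1 : ℝ) := by
    refine intervalIntegral.integral_congr fun u hu => ?_
    rw [Set.uIcc_of_le (by linarith)] at hu
    simp [Allocation.appendAgent, hu.1.not_gt]
  rw [this]
  simp

/-- If the added agent does not finish last, the cost product is at least `K * K`. -/
theorem Allocation.makespan_le_or_sq_le (hk : ∀ i, 1 ≤ I.k i)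
    (B : Allocation (I.addAgent r K hK)) (r₀ : Fin m) :
    ENNReal.ofReal (K + ∑ i, I.k i * I.d i r₀) ≤ (I.addAgent r K hK).cost 0 (B.bundle 0) ∨
      ENNReal.ofReal (K * K) ≤ B.costProduct := by
  obtain ⟨S, hS⟩ : ∃ S, S = (I.addAgent r K hK).cost 0 (B.bundle 0) := ⟨_, rfl⟩
  rw [B.costProduct_removeAgent, ← hS]
  by_cases htop : S = ⊤
  · simp [htop]
  -- If the added agent is last, the whole demand for `r₀` has been served by time `S`. Otherwise
  -- some other cost exceeds `S ≥ K`.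
  by_cases hlast : ∀ i : Fin n, (I.addAgent r K hK).cost i.succ (B.bundle i.succ) ≤ S
  · left
    have hall : ∀ i, (I.addAgent r K hK).cost i (B.bundle i) ≤ ENNReal.ofReal S.toReal := by
      rw [ENNReal.ofReal_toReal htop]
      exact Fin.cases hS.ge hlast
    have h1 := B.sum_integral_le le_rfl (ENNReal.toReal_nonneg (a := S)) r₀
    have h2 := Finset.sum_le_sum fun i (_ : i ∈ Finset.univ) =>
      (B.cost_le_iff i i ENNReal.toReal_nonneg).1 (hall i) r₀
    rw [ENNReal.ofReal_le_iff_le_toReal htop]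
    refine le_trans (le_of_eq ?_) (h2.trans (h1.trans_eq (sub_zero _)))
    simp [Fin.sum_univ_succ, Problem.addAgent]
  · right
    push Not at hlast
    obtain ⟨i, hi⟩ := hlast
    have hKS : ENNReal.ofReal K ≤ S := hS ▸ B.k_le_cost 0 0
    rw [ENNReal.ofReal_mul hK.le]
    refine mul_le_mul' hKS ((hKS.trans hi.le).trans ?_)
    -- The normalization `1 ≤ I.k j` keeps the remaining factors from shrinking the product.
    have hone : ∀ j, 1 ≤ I.cost j (B.removeAgent.bundle j) := fun j =>
      (by simpa using hk j : (1 : ℝ≥0∞) ≤ ENNReal.ofReal (I.k j)).trans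
        (B.removeAgent.k_le_cost j j)
    unfold Allocation.costProduct
    rw [← Finset.mul_prod_erase _ _ (Finset.mem_univ i)]
    exact le_mul_of_one_le_right' (Finset.one_le_prod' fun j _ => hone j)

/-- Serving the added agent after an old LCP allocation that is done by `W` costs `K + W` times the
old product `p`. For large `K` this is below `K * K`, so an optimal allocation finishes the added
agent no earlier than `K + W`. Cancelling that factor shows that its restriction is LCP for the old
agents, who keep their envy. -/
theorem Problem.ForcesEnvy.exists_addAgent (h : I.ForcesEnvy) :
    ∃ I' : Problem (n + 1) m, I'.ForcesEnvy := by
  obtain ⟨hk, ⟨r, A, hA, hfin, hW⟩, i, j, hij⟩ := h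
  set W := ∑ i, I.k i * I.d i r with hWdef
  have hW0 : 0 ≤ W :=
    Finset.sum_nonneg fun i _ => mul_nonneg (I.k_pos i).le (I.d_nonneg i r)
  set p := A.costProduct.toReal with hp
  have hp0 : 0 ≤ p := ENNReal.toReal_nonneg
  have hAp : A.costProduct = ENNReal.ofReal p := (ENNReal.ofReal_toReal hfin).symm
  -- With `K > W` and `K > 2 * p`, one gets `(K + W) * p ≤ 2 * K * p < K * K`.
  obtain ⟨K, hKdef⟩ : ∃ K, K = 2 * p + W + 1 := ⟨_, rfl⟩
  have hK : 0 < K := by linarith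
  have hKK : (K + W) * p < K * K := by nlinarith
  have hKW : ENNReal.ofReal (K + W) ≠ 0 := by
    rw [Ne, ENNReal.ofReal_eq_zero]; linarith
  have hbound : ∀ B : Allocation (I.addAgent r K hK),
      ENNReal.ofReal (K + W) * A.costProduct ≤ B.costProduct ∧
      (B.costProduct ≤ ENNReal.ofReal (K + W) * A.costProduct →
        B.removeAgent.costProduct ≤ A.costProduct) := by
    intro B
    rcases B.makespan_le_or_sq_le hk r with h | h
    · rw [B.costProduct_removeAgent]
      refine ⟨mul_le_mul' h (hA _), fun h' => ?_⟩
      exact (ENNReal.mul_le_mul_iff_right hKW ENNReal.ofReal_ne_top).1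
        ((mul_le_mul_left h _).trans h')
    · have : ENNReal.ofReal (K + W) * A.costProduct < B.costProduct := by
        rw [hAp, ← ENNReal.ofReal_mul (by linarith)]
        exact ((ENNReal.ofReal_lt_ofReal_iff (by positivity)).2 hKK).trans_le h
      exact ⟨this.le, fun h' => absurd h' this.not_ge⟩
  set A' := A.appendAgent r K hK W with hA'
  have hdone : ∀ s, K ≤ ∫ u in (0 : ℝ)..(K + W), A'.toFun u 0 s := by
    intro s
    have h1 := A'.integral_add le_rfl hW0 (by linarith : 0 ≤ K + W) 0 s
    have h2 := A'.integral_nonneg le_rfl hW0 0 s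
    rw [A.integral_appendAgent_zero r K hK s] at h1
    linarith
  have hcp : A'.costProduct ≤ ENNReal.ofReal (K + W) * A.costProduct := by
    rw [A'.costProduct_removeAgent]
    refine mul_le_mul' ((A'.cost_le_iff 0 0 (by linarith)).2 fun s => ?_)
      (Finset.prod_le_prod' fun i _ => ?_)
    · simpa [Problem.addAgent] using hdone s
    -- Every old agent finishes by `W`, before the hand-over, so its completion time is unaffected.
    · have hne := A.cost_ne_top_of_costProduct_ne_top hfin i
      have hle : (I.cost i (A.bundle i)).toReal ≤ W :=
        ENNReal.toReal_le_of_le_ofReal hW0 ((A.cost_le_iff i i hW0).2 (hW i))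
      rw [← ENNReal.ofReal_toReal hne, Allocation.cost_le_iff _ _ _ ENNReal.toReal_nonneg]
      intro s
      refine (A.integral_cost_ge hne le_rfl s).trans_eq ?_
      exact (A.integral_appendAgent_succ r K hK ENNReal.toReal_nonneg hle i s).symm
  have hLCP : A'.IsLCP := fun B => hcp.trans (hbound B).1
  refine ⟨I.addAgent r K hK, ?_, ⟨r, A', hLCP,
    (hcp.trans_lt (ENNReal.mul_lt_top ENNReal.ofReal_lt_top hfin.lt_top)).ne, ?_⟩,
    i.succ, j.succ, fun B hB => ?_⟩
  · refine Fin.cases ?_ hk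
    simp only [Problem.addAgent, Fin.cons_zero]
    linarith
  · have hsum : ∑ i, (I.addAgent r K hK).k i * (I.addAgent r K hK).d i r = K + W := by
      simp [Fin.sum_univ_succ, Problem.addAgent, hWdef]
    rw [hsum]
    refine Fin.cases (fun s => ?_) fun i s => ?_
    · simpa [Problem.addAgent] using hdone s
    · have h1 := A'.integral_add le_rfl hW0 (by linarith : 0 ≤ K + W) i.succ s
      have h2 := A'.integral_nonneg hW0 (by linarith : W ≤ K + W) i.succ s
      rw [A.integral_appendAgent_succ r K hK hW0 le_rfl i s] at h1
      have h3 := hW i s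
      change I.k i * I.d i s ≤ _
      linarith
  · rw [← B.cost_removeAgent, ← B.cost_removeAgent]
    exact hij _ fun C => ((hbound B).2 ((hB A').trans hcp)).trans (hA C)

end AddAgent

/-! ### Impossibility for all sizes -/

theorem exists_forcesEnvy {n m : ℕ} (hn : 3 ≤ n) (hm : 2 ≤ m) :
    ∃ I : Problem n m, I.ForcesEnvy := by
  induction n, hn using Nat.le_induction with
  | base =>
    -- All resources but the first become copies of the second one.
    have hf : Function.Surjective (fun r : Fin m => if r.val = 0 then (0 : Fin 2) else 1) := by
      intro s
      fin_cases s
      · exact ⟨⟨0, by omega⟩, by simp⟩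
      · exact ⟨⟨1, by omega⟩, by simp⟩
    exact ⟨_, (envyProblem_forcesEnvy (ε := 1 / 10) (k := 3) (hε := by norm_num)
      (hε1 := by norm_num) (hk := by norm_num) (by norm_num)).copyResources hf⟩
  | succ n _ ih =>
    obtain ⟨I, hI⟩ := ih
    exact hI.exists_addAgent

theorem Mechanism.IsLCP.not_isEnvyFree {n m : ℕ} (hn : 3 ≤ n) (hm : 2 ≤ m) {f : Mechanism n m}
    (hf : f.IsLCP) : ¬ f.IsEnvyFree := by
  intro h
  obtain ⟨I, -, ⟨-, A, hA, -⟩, i, j, hij⟩ := exists_forcesEnvy hn hm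
  obtain ⟨h1, h2⟩ := hij _ (hf I ⟨A, hA⟩)
  exact absurd (h2.trans ((h I i j).trans h1)) (by norm_num)

/-- The envious pair and the bounds 1 and 2 are the same for all LCP allocations, so they survive
averaging over the seed. -/
theorem RandomizedMechanism.IsLCP.not_isEnvyFreeInExpectation {n m : ℕ} (hn : 3 ≤ n)
    (hm : 2 ≤ m) {F : RandomizedMechanism n m} (hF : F.IsLCP) :
    ¬ F.IsEnvyFreeInExpectation := by
  intro h
  obtain ⟨I, -, ⟨-, A, hA, -⟩, i, j, hij⟩ := exists_forcesEnvy hn hm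
  have hae := hF I ⟨A, hA⟩
  have h1 : ∫⁻ ω, I.cost i ((F.alloc I ω).bundle j) ∂F.P ≤ 1 := by
    refine (lintegral_mono_ae (hae.mono fun ω hω => (hij _ hω).1)).trans_eq ?_
    simp
  have h2 : 2 ≤ ∫⁻ ω, I.cost i ((F.alloc I ω).bundle i) ∂F.P := by
    refine le_of_eq_of_le ?_ (lintegral_mono_ae (hae.mono fun ω hω => (hij _ hω).2))
    simp
  exact absurd (h2.trans ((h I i j).trans h1)) (by norm_num)

end LimitedDemands

theorem lemma5 :
    (∀ n m : ℕ, 3 ≤ n → 2 ≤ m →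
      (∀ f : LimitedDemands.Mechanism n m, f.IsLCP → ¬ f.IsEnvyFree) ∧
      (∀ F : LimitedDemands.RandomizedMechanism n m, F.IsLCP → ¬ F.IsEnvyFreeInExpectation)) ∧
    (∀ (ε k₃ : ℝ) (hε : 0 < ε) (hε1 : ε < 1) (hk : 2 < k₃), k₃ < 2 / ε - 3 - ε →
      (∃ A : LimitedDemands.Allocation (LimitedDemands.envyProblem ε k₃ hε hε1 hk), A.IsLCP) ∧
      ∀ A : LimitedDemands.Allocation (LimitedDemands.envyProblem ε k₃ hε hε1 hk),
        (A.IsLCP ↔ ∀ᵐ t : ℝ, 0 ≤ t → t < 1 + ε + k₃ →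
          A.toFun t = LimitedDemands.envySchedule ε t) ∧
        (A.IsLCP →
          (LimitedDemands.envyProblem ε k₃ hε hε1 hk).cost 0 (A.bundle 0) = ENNReal.ofReal 1 ∧
          (LimitedDemands.envyProblem ε k₃ hε hε1 hk).cost 1 (A.bundle 1)
            = ENNReal.ofReal (2 + ε) ∧
          (LimitedDemands.envyProblem ε k₃ hε hε1 hk).cost 2 (A.bundle 2)
            = ENNReal.ofReal (1 + ε + k₃) ∧
          (LimitedDemands.envyProblem ε k₃ hε hε1 hk).cost 1 (A.bundle 0) = ENNReal.ofReal 1 ∧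
          (LimitedDemands.envyProblem ε k₃ hε hε1 hk).cost 1 (A.bundle 0)
            < (LimitedDemands.envyProblem ε k₃ hε hε1 hk).cost 1 (A.bundle 1))) := by
  refine ⟨fun n m hn hm => ⟨fun f hf => hf.not_isEnvyFree hn hm,
    fun F hF => hF.not_isEnvyFreeInExpectation hn hm⟩, fun ε k₃ hε hε1 hk hkε => ?_⟩
  refine ⟨⟨_, (LimitedDemands.envyProblem_isLCP_iff_costProduct_le hkε _).2
    (LimitedDemands.envyAllocation_costProduct_le ε k₃ hε hε1 hk)⟩, fun A =>
    ⟨LimitedDemands.envyProblem_isLCP_iff_ae_eq hkε A, fun hA => ?_⟩⟩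
  obtain ⟨h0, h1, h2, hopt⟩ := (LimitedDemands.envyProblem_costProduct_bound A hkε).2
    ((LimitedDemands.envyProblem_isLCP_iff_costProduct_le hkε A).1 hA)
  have h10 := LimitedDemands.envyProblem_cost_one_bundle_zero A hopt.1
  refine ⟨h0, h1, h2, h10, ?_⟩
  rw [h10, h1]
  exact (ENNReal.ofReal_lt_ofReal_iff (by linarith)).2 (by linarith)
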